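/- **Setting.** Let $\Gamma$ be a (typically infinite) set of lattice sites and let $\mathcal A$ be a unital $C^*$-algebra with a family of local subalgebras $\mathcal A(I)$, $I\Subset\Gamma$ finite, each a full matrix algebra, increasing in $I$ and with norm dense union. For arbitrary $S\subset\Gamma$, $\mathcal A(S)$ is the norm closure of $\bigcup_{I\Subset S}\mathcal A(I)$. Suppose that $\mathcal A$ is either a *quantum spin lattice system*, i.e. $\mathcal A(I\cup J)=\mathcal A(I)\otimes\mathcal A(J)$ for disjoint finite $I,J$, or a *fermion lattice system*, i.e. $\mathcal A$ is generated by $c_i$ ($i\in\Gamma$) satisfying the canonical anticommutation relations, and $\mathcal A(I)$ is generated by $c_i,c_i^*$, $i\in I$. In the fermion case let $\Theta$ be the automorphism of $\mathcal A$ with $\Theta(c_i)=-c_i$; an element or a state is *even* if it is $\Theta$-invariant. For a state $\psi$ let $S_I(\psi)=-\mathrm{Tr}(D\log D)$ be the von Neumann entropy of its restriction to $\mathcal A(I)$, $D$ being the density matrix. For finite $I$ and $J\subset I^c$ (finite or infinite) put $$\widetilde S_{I|J}(\psi)=\inf_{\Lambda\Subset J}\{S_{I\cup\Lambda}(\psi)-S_\Lambda(\psi)\},\qquad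 I_\psi(I:J)=S_I(\psi)-\widetilde S_{I|J}(\psi).$$ A *potential* $\Phi$ assigns to each finite $K\Subset\Gamma$ a self-adjoint $\Phi(K)\in\mathcal A(K)$ (even, in the fermion case) such that for every finite $I$ the surface energy $$H_{\partial I}=\sum_{K\cap I\neq\emptyset,\ K\cap I^c\neq\emptyset}\Phi(K)$$ exists in $\mathcal A$, as the norm limit over finite $J\nearrow\Gamma$ of the sums over $K\subset J$. Put $H_I=\sum_{K\subset I}\Phi(K)$. A state $\varphi$ satisfies *local thermodynamical stability* (LTS) for $\Phi$ at inverse temperature $\beta>0$ if for every finite $I$ it minimizes $$\widetilde F_I(\psi)=\psi(H_I+H_{\partial I})-\tfrac1\beta\,\widetilde S_{I|I^c}(\psi)$$ among all states $\psi$ of $\mathcal A$ that agree with $\varphi$ on $\mathcal A(I^c)$. Let $\partial A$ denote the support of $H_{\partial A}$, i.e. the smallest region $S$ with $H_{\partial A}\in\mathcal A(S)$, and $|\partial A|\in\{0,1,2,\dots,\infty\}$ its number of sites. **Claim (geometric thermal area law).** Let $\beta>0$ and let $\varphi$ be a state satisfying LTS for $\Phi$ at inverse temperature $\beta$ in the quantum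 spin case, or an even such state in the fermion case. Let $A\Subset\Gamma$ be finite and let $c_\Phi>0$ be a constant with $\lVert H_{\partial A}\rVert\le c_\Phi\,|\partial A|$. Then for every (finite or infinite) region $B\subset A^c$, $$I_\varphi(A:B)\le 2\beta\,c_\Phi\,|\partial A| .$$ -/

import Mathlib

open Filter Topology
open scoped ComplexOrder

namespace QLattice

/-! ## Quasi-local systems, regions, states -/

/-- A quasi-local C*-system on the lattice `Γ` with total algebra `𝒜`: an increasing family of
local subalgebras, one for each finite region, each a full matrix algebra, with norm dense union. -/
structure QuasiLocal (Γ : Type*) (𝒜 : Type*) [CStarAlgebra 𝒜] where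
  /-- the local algebra of a finite region -/
  loc : Finset Γ → StarSubalgebra ℂ 𝒜
  mono : ∀ I J : Finset Γ, I ⊆ J → loc I ≤ loc J
  matrix : ∀ I : Finset Γ, ∃ n : ℕ, Nonempty (loc I ≃⋆ₐ[ℂ] Matrix (Fin n) (Fin n) ℂ)
  dense : Dense (⋃ I : Finset Γ, (loc I : Set 𝒜))

/-- A quantum spin lattice system: for disjoint finite regions `I`, `J`, the algebra of `I ∪ J` is
the tensor product of the algebras of `I` and of `J`, that is, the two subalgebras commute, the
multiplication map from their algebraic tensor product is injective, and they generate. -/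
structure SpinSystem (Γ : Type*) (𝒜 : Type*) [DecidableEq Γ] [CStarAlgebra 𝒜] extends
    QuasiLocal Γ 𝒜 where
  commute : ∀ I J : Finset Γ, Disjoint I J → ∀ a ∈ loc I, ∀ b ∈ loc J, a * b = b * a
  linearDisjoint : ∀ I J : Finset Γ, Disjoint I J →
    (loc I).toSubalgebra.LinearDisjoint (loc J).toSubalgebra
  sup : ∀ I J : Finset Γ, Disjoint I J → loc (I ∪ J) = loc I ⊔ loc J

/-- A (spinless) fermion lattice system: annihilation operators `c i`, one for each site, satisfying
the canonical anticommutation relations and generating the C*-algebra `𝒜`. -/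
structure FermionSystem (Γ : Type*) (𝒜 : Type*) [DecidableEq Γ] [CStarAlgebra 𝒜] where
  /-- the annihilation operator of a site -/
  c : Γ → 𝒜
  car : ∀ i j : Γ, star (c i) * c j + c j * star (c i) = if i = j then 1 else 0
  car_zero : ∀ i j : Γ, c i * c j + c j * c i = 0
  dense : Dense (StarAlgebra.adjoin ℂ (Set.range c) : Set 𝒜)

/-- A state: a positive normalized linear functional. -/
structure State (𝒜 : Type*) [CStarAlgebra 𝒜] where
  /-- the underlying functional -/
  toLin : 𝒜 →ₗ[ℂ] ℂ
  nonneg : ∀ a : 𝒜, 0 ≤ toLin (star a * a)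
  map_one : toLin 1 = 1

noncomputable instance (𝒜 : Type*) [CStarAlgebra 𝒜] : CoeFun (State 𝒜) (fun _ => 𝒜 → ℂ) :=
  ⟨fun φ => φ.toLin⟩

namespace FermionSystem

variable {Γ 𝒜 : Type*} [DecidableEq Γ] [CStarAlgebra 𝒜] (F : FermionSystem Γ 𝒜)

/-- The local algebra of a finite region, generated by the `c i` and their adjoints. -/
def loc (I : Finset Γ) : StarSubalgebra ℂ 𝒜 := StarAlgebra.adjoin ℂ (F.c '' (I : Set Γ))

theorem loc_mono (I J : Finset Γ) (h : I ⊆ J) : F.loc I ≤ F.loc J :=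
  StarAlgebra.adjoin_mono (Set.image_mono (Finset.coe_subset.mpr h))

theorem c_mem (i : Γ) (I : Finset Γ) (h : i ∈ I) : F.c i ∈ F.loc I :=
  StarAlgebra.subset_adjoin ℂ _ ⟨i, h, rfl⟩

theorem local_dense : Dense (⋃ I : Finset Γ, (F.loc I : Set 𝒜)) := by
  refine F.dense.mono fun a ha => ?_
  rw [Set.mem_iUnion]
  refine StarAlgebra.adjoin_induction (p := fun a _ => ∃ I, a ∈ (F.loc I : Set 𝒜))
    ?_ ?_ ?_ ?_ ?_ ha
  · rintro _ ⟨i, rfl⟩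
    exact ⟨{i}, F.c_mem i _ (Finset.mem_singleton_self i)⟩
  · exact fun r => ⟨∅, (F.loc ∅).algebraMap_mem r⟩
  · rintro x y _ _ ⟨I, hI⟩ ⟨J, hJ⟩
    exact ⟨I ∪ J, add_mem (F.loc_mono I _ Finset.subset_union_left hI)
      (F.loc_mono J _ Finset.subset_union_right hJ)⟩
  · rintro x y _ _ ⟨I, hI⟩ ⟨J, hJ⟩
    exact ⟨I ∪ J, mul_mem (F.loc_mono I _ Finset.subset_union_left hI)
      (F.loc_mono J _ Finset.subset_union_right hJ)⟩
  · rintro x _ ⟨I, hI⟩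
    exact ⟨I, star_mem (s := F.loc I) hI⟩

theorem c_sq (i : Γ) : F.c i * F.c i = 0 := by
  have h := F.car_zero i i
  rw [← two_smul ℂ, smul_eq_zero] at h
  exact h.resolve_left two_ne_zero

theorem c_anti (i j : Γ) : F.c i * F.c j = -(F.c j * F.c i) :=
  eq_neg_of_add_eq_zero_left (F.car_zero i j)

theorem star_anti (i j : Γ) (h : i ≠ j) : star (F.c i) * F.c j = -(F.c j * star (F.c i)) :=
  eq_neg_of_add_eq_zero_left (by rw [F.car i j, if_neg h])

theorem star_self (i : Γ) : star (F.c i) * F.c i = 1 - F.c i * star (F.c i) :=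
  eq_sub_of_add_eq (by rw [F.car i i, if_pos rfl])

/-- A self-adjoint unitary in the algebra of `I` which anticommutes with `c i` for `i` in `I`, and
commutes with the other `c j`. -/
theorem exists_parity (I : Finset Γ) : ∃ u : 𝒜, u ∈ F.loc I ∧ star u = u ∧ u * u = 1 ∧
    (∀ i ∈ I, u * F.c i = -(F.c i * u)) ∧ (∀ j, j ∉ I → u * F.c j = F.c j * u) := by
  induction I using Finset.induction_on with
  | empty => exact ⟨1, one_mem _, star_one _, mul_one _, by simp, by simp⟩
  | insert j I hj ih =>
    obtain ⟨u, hu, hs, h1, ha, hc⟩ := ih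
    have hcj := F.c_mem j (insert j I) (Finset.mem_insert_self j I)
    set v : 𝒜 := 1 - (2 : ℂ) • (star (F.c j) * F.c j) with hv
    have uc : u * F.c j = F.c j * u := hc j hj
    have us : u * star (F.c j) = star (F.c j) * u := by
      have := congrArg star uc
      rw [star_mul, star_mul, hs] at this
      exact this.symm
    have uN : u * (star (F.c j) * F.c j) = star (F.c j) * F.c j * u := by
      rw [← mul_assoc, us, mul_assoc, uc, mul_assoc]
    have uv : u * v = v * u := by
      simp only [hv, mul_sub, sub_mul, mul_one, one_mul, mul_smul_comm, smul_mul_assoc, uN]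
    have sv : star v = v := by
      simp [hv, star_sub, star_smul, star_mul]
    have cN : star (F.c j) * F.c j * F.c j = 0 := by rw [mul_assoc, F.c_sq, mul_zero]
    have Nc : F.c j * (star (F.c j) * F.c j) = F.c j := by
      rw [F.star_self, mul_sub, mul_one, ← mul_assoc, F.c_sq, zero_mul, sub_zero]
    have NN : star (F.c j) * F.c j * (star (F.c j) * F.c j) = star (F.c j) * F.c j := by
      rw [mul_assoc, Nc]
    have vv : v * v = 1 := by
      simp only [hv, mul_sub, sub_mul, mul_one, one_mul, mul_smul_comm, smul_mul_assoc, NN]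
      module
    have vc : v * F.c j = -(F.c j * v) := by
      simp only [hv, mul_sub, sub_mul, mul_one, one_mul, mul_smul_comm, smul_mul_assoc, cN, Nc]
      module
    have vo : ∀ i, i ≠ j → v * F.c i = F.c i * v := by
      intro i hi
      have : star (F.c j) * F.c j * F.c i = F.c i * (star (F.c j) * F.c j) := by
        rw [mul_assoc, F.c_anti j i, mul_neg, ← mul_assoc, F.star_anti j i (Ne.symm hi), neg_mul,
          neg_neg, mul_assoc]
      simp only [hv, mul_sub, sub_mul, mul_one, one_mul, mul_smul_comm, smul_mul_assoc, this]
    refine ⟨u * v, ?_, ?_, ?_, ?_, ?_⟩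
    · refine mul_mem (F.loc_mono I _ (Finset.subset_insert j I) hu) ?_
      exact sub_mem (one_mem _) (SMulMemClass.smul_mem _ (mul_mem (star_mem hcj) hcj))
    · rw [star_mul, hs, sv, uv]
    · rw [mul_assoc, ← mul_assoc v, ← uv, mul_assoc u, vv, mul_one, h1]
    · intro i hi
      by_cases hij : i = j
      · subst hij
        rw [mul_assoc, vc, mul_neg, ← mul_assoc, uc, mul_assoc]
      · have hi' : i ∈ I := (Finset.mem_insert.mp hi).resolve_left hij
        rw [mul_assoc, vo i hij, ← mul_assoc, ha i hi', neg_mul, mul_assoc]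
    · intro i hi
      rw [Finset.mem_insert, not_or] at hi
      rw [mul_assoc, vo i hi.1, ← mul_assoc, hc i hi.2, mul_assoc]

/-- Two inner automorphisms that agree on the generators of a local algebra agree on it. -/
theorem conj_eq_of_gen (u v : 𝒜) (hu : star u = u) (hu1 : u * u = 1) (hv : star v = v)
    (hv1 : v * v = 1) (I : Finset Γ) (h : ∀ i ∈ I, u * F.c i * u = v * F.c i * v) (a : 𝒜)
    (ha : a ∈ F.loc I) : u * a * u = v * a * v := by
  refine StarAlgebra.adjoin_induction (p := fun a _ => u * a * u = v * a * v)
    ?_ ?_ ?_ ?_ ?_ ha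
  · rintro _ ⟨i, hi, rfl⟩
    exact h i hi
  · intro r
    rw [← Algebra.commutes, ← Algebra.commutes, mul_assoc, mul_assoc, hu1, hv1]
  · intro x y _ _ hx hy
    rw [mul_add, mul_add, add_mul, add_mul, hx, hy]
  · intro x y _ _ hx hy
    calc u * (x * y) * u = u * x * (u * u) * y * u := by rw [hu1]; simp only [mul_assoc, one_mul]
      _ = u * x * u * (u * y * u) := by simp only [mul_assoc]
      _ = v * x * v * (v * y * v) := by rw [hx, hy]
      _ = v * x * (v * v) * y * v := by simp only [mul_assoc]
      _ = v * (x * y) * v := by rw [hv1]; simp only [mul_assoc, one_mul]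
  · intro x _ hx
    have := congrArg star hx
    simpa [star_mul, hu, hv, mul_assoc] using this

/-- The grading automorphism exists and is unique. -/
theorem exists_grading : ∃ Θ : 𝒜 ≃⋆ₐ[ℂ] 𝒜, ∀ i, Θ (F.c i) = -F.c i := by
  choose u hu hs h1 ha hc using F.exists_parity
  have norm_le : ∀ I a, ‖u I * a * u I‖ ≤ ‖a‖ := by
    intro I a
    have hn : ‖u I‖ ≤ 1 := by
      have h := CStarRing.norm_star_mul_self (x := u I)
      rw [hs, h1] at h
      have h2 : ‖(1 : 𝒜)‖ ≤ 1 := by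
        rcases subsingleton_or_nontrivial 𝒜 with _ | _
        · rw [Subsingleton.elim (1 : 𝒜) 0, norm_zero]; exact zero_le_one
        · exact CStarRing.norm_one.le
      nlinarith [norm_nonneg (u I)]
    calc ‖u I * a * u I‖ ≤ ‖u I‖ * ‖a‖ * ‖u I‖ := norm_mul₃_le
      _ ≤ 1 * ‖a‖ * 1 := by gcongr
      _ = ‖a‖ := by ring
  have gen : ∀ I, ∀ i ∈ I, u I * F.c i * u I = -F.c i := by
    intro I i hi
    rw [ha I i hi, neg_mul, mul_assoc, h1, mul_one]
  have stable : ∀ I J, I ⊆ J → ∀ a ∈ F.loc I, u J * a * u J = u I * a * u I := by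
    intro I J hIJ a haI
    refine F.conj_eq_of_gen _ _ (hs J) (h1 J) (hs I) (h1 I) I (fun i hi => ?_) a haI
    rw [gen I i hi, gen J i (hIJ hi)]
  have lim : ∀ a, ∃ b, Tendsto (fun I => u I * a * u I) atTop (𝓝 b) := by
    intro a
    refine cauchySeq_tendsto_of_complete (Metric.cauchySeq_iff'.mpr fun ε hε => ?_)
    obtain ⟨b, hb, hab⟩ := Metric.mem_closure_iff.mp (F.local_dense a) (ε / 2) (half_pos hε)
    obtain ⟨I, hI⟩ := Set.mem_iUnion.mp hb
    refine ⟨I, fun J hJ => ?_⟩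
    have e : u J * a * u J - u I * a * u I = u J * (a - b) * u J - u I * (a - b) * u I := by
      have := stable I J hJ b hI
      simp only [mul_sub, sub_mul, this]
      abel
    rw [dist_eq_norm] at hab ⊢
    rw [e]
    have n1 := norm_le J (a - b)
    have n2 := norm_le I (a - b)
    linarith [norm_sub_le (u J * (a - b) * u J) (u I * (a - b) * u I)]
  choose T hT using lim
  have T_mul : ∀ a b, T (a * b) = T a * T b := by
    intro a b
    refine tendsto_nhds_unique (hT (a * b)) (((hT a).mul (hT b)).congr fun I => ?_)
    calc u I * a * u I * (u I * b * u I) = u I * a * (u I * u I) * b * u I := by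
          simp only [mul_assoc]
      _ = u I * (a * b) * u I := by rw [h1]; simp only [mul_assoc, one_mul]
  have T_add : ∀ a b, T (a + b) = T a + T b := by
    intro a b
    refine tendsto_nhds_unique (hT (a + b)) (((hT a).add (hT b)).congr fun I => ?_)
    rw [mul_add, add_mul]
  have T_smul : ∀ (r : ℂ) a, T (r • a) = r • T a := by
    intro r a
    refine tendsto_nhds_unique (hT (r • a)) (((hT a).const_smul r).congr fun I => ?_)
    rw [mul_smul_comm, smul_mul_assoc]
  have T_star : ∀ a, T (star a) = star (T a) := by
    intro a
    refine tendsto_nhds_unique (hT (star a)) ((hT a).star.congr fun I => ?_)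
    simp only [star_mul, hs, mul_assoc]
  have T_norm : ∀ a, ‖T a‖ ≤ ‖a‖ := fun a =>
    le_of_tendsto (hT a).norm (Eventually.of_forall fun I => norm_le I a)
  have T_loc : ∀ I, ∀ a ∈ F.loc I, T a = u I * a * u I := by
    intro I a haI
    refine tendsto_nhds_unique (hT a) (tendsto_const_nhds.congr' ?_)
    filter_upwards [eventually_ge_atTop I] with J hJ
    exact (stable I J hJ a haI).symm
  have T_cont : Continuous T := by
    refine LipschitzWith.continuous (K := 1) (LipschitzWith.of_dist_le_mul fun a b => ?_)
    have : T a - T b = T (a - b) := by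
      rw [sub_eq_add_neg, sub_eq_add_neg, T_add, ← neg_one_smul ℂ b, T_smul, neg_one_smul]
    rw [dist_eq_norm, dist_eq_norm, this, NNReal.coe_one, one_mul]
    exact T_norm _
  have T_invol : ∀ a, T (T a) = a := by
    have : T ∘ T = id := by
      refine Continuous.ext_on F.local_dense (T_cont.comp T_cont) continuous_id ?_
      intro a haU
      obtain ⟨I, hI⟩ := Set.mem_iUnion.mp haU
      have hI' : u I * a * u I ∈ F.loc I := mul_mem (mul_mem (hu I) hI) (hu I)
      simp only [Function.comp_apply, id_eq]
      rw [T_loc I a hI, T_loc I _ hI']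
      calc u I * (u I * a * u I) * u I = (u I * u I) * a * (u I * u I) := by simp only [mul_assoc]
        _ = a := by rw [h1, one_mul, mul_one]
    exact fun a => congrFun this a
  refine ⟨{ toFun := T, invFun := T, left_inv := T_invol, right_inv := T_invol, map_mul' := T_mul
            map_add' := T_add, map_star' := T_star, map_smul' := T_smul }, fun i => ?_⟩
  change T (F.c i) = -F.c i
  rw [T_loc {i} _ (F.c_mem i _ (Finset.mem_singleton_self i))]
  exact gen _ i (Finset.mem_singleton_self i)

/-- The grading automorphism `Θ`, the one that maps every `c i` to `- c i` (unique because the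
`c i` generate). -/
noncomputable def grading : 𝒜 ≃⋆ₐ[ℂ] 𝒜 := F.exists_grading.choose

theorem grading_c (i : Γ) : F.grading (F.c i) = -F.c i := F.exists_grading.choose_spec i

/-- A state is even if it is invariant under the grading automorphism. -/
def IsEvenState (φ : State 𝒜) : Prop := ∀ a : 𝒜, φ (F.grading a) = φ a

/-- Adjoining one more mode doubles the matrix size: `e` represents a matrix algebra, and `b` is
an annihilation operator commuting with its range. -/
theorem double {ι : Type} [Fintype ι] [DecidableEq ι] (e : Matrix ι ι ℂ →⋆ₐ[ℂ] 𝒜) (b : 𝒜)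
    (hb : b * b = 0) (hbb : star b * b + b * star b = 1)
    (hc : ∀ X, e X * b = b * e X) :
    ∃ e' : Matrix (Fin 2 × ι) (Fin 2 × ι) ℂ →⋆ₐ[ℂ] 𝒜,
      (∀ M, ∃ x : Fin 2 → Fin 2 → Matrix ι ι ℂ, e' M = e (x 0 0) * (b * star b) + e (x 0 1) * b +
        e (x 1 0) * star b + e (x 1 1) * (star b * b)) ∧
      (∀ X, ∃ M, e' M = e X) ∧ (∃ M, e' M = b) := by
  have hcs : ∀ X, e X * star b = star b * e X := by
    intro X
    have h := congrArg star (hc (star X))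
    rw [star_mul, star_mul, map_star, star_star] at h
    exact h.symm
  have hsb : star b * star b = 0 := by rw [← star_mul, hb, star_zero]
  have b1 : b * (star b * b) = b := by
    have : star b * b = 1 - b * star b := eq_sub_of_add_eq hbb
    rw [this, mul_sub, mul_one, ← mul_assoc, hb, zero_mul, sub_zero]
  have b2 : star b * (b * star b) = star b := by
    have : b * star b = 1 - star b * b := eq_sub_of_add_eq' hbb
    rw [this, mul_sub, mul_one, ← mul_assoc, hsb, zero_mul, sub_zero]
  have bb0 : ∀ x, b * (b * x) = 0 := fun x => by rw [← mul_assoc, hb, zero_mul]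
  have ss0 : ∀ x, star b * (star b * x) = 0 := fun x => by rw [← mul_assoc, hsb, zero_mul]
  have b3 : b * (star b * (b * star b)) = b * star b := by rw [b2]
  have b4 : star b * (b * (star b * b)) = star b * b := by rw [b1]
  let f : Fin 2 → Fin 2 → 𝒜 := ![![b * star b, b], ![star b, star b * b]]
  have hf : ∀ p q r s, f p q * f r s = if q = r then f p s else 0 := by
    intro p q r s
    fin_cases p <;> fin_cases q <;> fin_cases r <;> fin_cases s <;>
      simp [f, mul_assoc, hb, hsb, b1, b2, bb0, ss0]
  have hfs : ∀ p q, star (f p q) = f q p := by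
    intro p q
    fin_cases p <;> fin_cases q <;> simp [f]
  have hf1 : f 0 0 + f 1 1 = 1 := by
    simp only [f, Matrix.cons_val_zero, Matrix.cons_val_one]
    rw [add_comm]; exact hbb
  have hfc : ∀ X p q, f p q * e X = e X * f p q := by
    intro X p q
    fin_cases p <;> fin_cases q
    · simp only [f]
      change b * star b * e X = e X * (b * star b)
      rw [mul_assoc, ← hcs, ← mul_assoc, ← hc, mul_assoc]
    · exact (hc X).symm
    · exact (hcs X).symm
    · change star b * b * e X = e X * (star b * b)
      rw [mul_assoc, ← hc, ← mul_assoc, ← hcs, mul_assoc]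
  let blk : Matrix (Fin 2 × ι) (Fin 2 × ι) ℂ → Fin 2 → Fin 2 → Matrix ι ι ℂ :=
    fun M p q => Matrix.of fun i j => M (p, i) (q, j)
  let T : Matrix (Fin 2 × ι) (Fin 2 × ι) ℂ → 𝒜 := fun M => ∑ p, ∑ q, e (blk M p q) * f p q
  have blk_mul : ∀ M N p s, blk (M * N) p s = ∑ q, blk M p q * blk N q s := by
    intro M N p s
    ext i j
    simp [blk, Matrix.mul_apply, Fintype.sum_prod_type, Matrix.sum_apply]
  have blk_one : ∀ p q, blk 1 p q = if p = q then 1 else 0 := by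
    intro p q
    ext i j
    by_cases h : p = q
    · simp [blk, h, Matrix.one_apply]
    · simp [blk, h]
  have T_one : T 1 = 1 := by
    simp only [T, blk_one, Fin.sum_univ_two]
    simp [hf1]
  have T_mul : ∀ M N, T (M * N) = T M * T N := by
    intro M N
    have key : ∀ p q r s, e (blk M p q) * f p q * (e (blk N r s) * f r s) =
        if q = r then e (blk M p q * blk N r s) * f p s else 0 := by
      intro p q r s
      calc e (blk M p q) * f p q * (e (blk N r s) * f r s)
          = e (blk M p q) * (f p q * e (blk N r s)) * f r s := by simp only [mul_assoc]
        _ = e (blk M p q * blk N r s) * (f p q * f r s) := by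
            rw [hfc, map_mul]; simp only [mul_assoc]
        _ = _ := by rw [hf]; split_ifs <;> simp
    simp only [T, blk_mul, map_sum, Finset.sum_mul, Finset.mul_sum, key]
    simp only [Fin.sum_univ_two]
    simp
    abel
  have T_star : ∀ M, T (star M) = star (T M) := by
    intro M
    have hb' : ∀ p q, blk (star M) p q = star (blk M q p) := by
      intro p q
      ext i j
      simp [blk, Matrix.star_apply]
    have : ∀ p q, e (blk (star M) p q) * f p q = star (e (blk M q p) * f q p) := by
      intro p q
      rw [hb', star_mul, hfs, map_star, ← map_star, hfc]
    simp only [T, this, star_sum]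
    exact Finset.sum_comm
  have T_smul : ∀ (r : ℂ) M, T (r • M) = r • T M := by
    intro r M
    have : ∀ p q, blk (r • M) p q = r • blk M p q := fun p q => rfl
    simp only [T, this, map_smul, smul_mul_assoc, Finset.smul_sum]
  have T_add : ∀ M N, T (M + N) = T M + T N := by
    intro M N
    have : ∀ p q, blk (M + N) p q = blk M p q + blk N p q := fun p q => rfl
    simp only [T, this, map_add, add_mul, Finset.sum_add_distrib]
  have T_zero : T 0 = 0 := by
    have := T_smul 0 0
    simpa using this
  refine ⟨{ toFun := T, map_one' := T_one, map_mul' := T_mul, map_zero' := T_zero,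
            map_add' := T_add, map_star' := T_star, commutes' := fun r => ?_ }, ?_, ?_, ?_⟩
  · change T (algebraMap ℂ _ r) = algebraMap ℂ _ r
    rw [Algebra.algebraMap_eq_smul_one, T_smul, T_one, Algebra.algebraMap_eq_smul_one]
  · intro M
    refine ⟨blk M, ?_⟩
    change T M = _
    simp only [T, Fin.sum_univ_two]
    simp [f, add_assoc]
  · intro X
    refine ⟨Matrix.of fun x y => if x.1 = y.1 then X x.2 y.2 else 0, ?_⟩
    change T _ = _
    have : ∀ p q, blk (Matrix.of fun x y => if x.1 = y.1 then X x.2 y.2 else 0) p q =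
        if p = q then X else 0 := by
      intro p q
      ext i j
      by_cases h : p = q <;> simp [blk, h]
    simp only [T, this, Fin.sum_univ_two]
    simp [← mul_add, hf1]
  · refine ⟨Matrix.of fun x y => if x.1 = 0 ∧ y.1 = 1 ∧ x.2 = y.2 then 1 else 0, ?_⟩
    change T _ = _
    have : ∀ p q, blk (Matrix.of fun x y => if x.1 = 0 ∧ y.1 = 1 ∧ x.2 = y.2 then 1 else 0) p q =
        if p = 0 ∧ q = 1 then 1 else 0 := by
      intro p q
      ext i j
      by_cases h : p = 0 ∧ q = 1
      · simp [blk, h, Matrix.one_apply]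
      · rw [if_neg h]
        simp only [blk, Matrix.of_apply, Matrix.zero_apply]
        exact if_neg fun h' => h ⟨h'.1, h'.2.1⟩
    simp only [T, this, Fin.sum_univ_two]
    simp [f]

/-- The local algebras are full matrix algebras. -/
theorem loc_matrix [Nontrivial 𝒜] (I : Finset Γ) :
    ∃ n : ℕ, Nonempty (F.loc I ≃⋆ₐ[ℂ] Matrix (Fin n) (Fin n) ℂ) := by
  have main : ∃ (ι : Type) (_ : Fintype ι) (_ : DecidableEq ι) (e : Matrix ι ι ℂ →⋆ₐ[ℂ] 𝒜),
      e.range = F.loc I := by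
    induction I using Finset.induction_on with
    | empty =>
      refine ⟨Unit, inferInstance, inferInstance,
        { toFun := fun M => algebraMap ℂ 𝒜 (M () ()), map_one' := by simp, map_zero' := by simp
          map_mul' := fun M N => by simp [Matrix.mul_apply]
          map_add' := fun M N => by simp
          map_star' := fun M => by
            rw [Matrix.star_apply, algebraMap_star_comm]
          commutes' := fun r => by simp [Matrix.algebraMap_matrix_apply] }, ?_⟩
      have h0 : F.loc ∅ = ⊥ := by
        rw [loc, Finset.coe_empty, Set.image_empty]
        exact le_antisymm (StarAlgebra.adjoin_le (Set.empty_subset _)) bot_le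
      rw [h0]
      ext a
      rw [StarSubalgebra.mem_bot]
      constructor
      · rintro ⟨M, rfl⟩
        exact ⟨M () (), rfl⟩
      · rintro ⟨r, rfl⟩
        exact ⟨Matrix.of fun _ _ => r, rfl⟩
    | insert j I hj ih =>
      obtain ⟨ι, _, _, e, he⟩ := ih
      obtain ⟨u, hu, hs, h1, ha, hc⟩ := F.exists_parity I
      have e_mem : ∀ X, e X ∈ F.loc I := fun X => he ▸ (⟨X, rfl⟩ : e X ∈ e.range)
      have mem_e : ∀ a ∈ F.loc I, ∃ X, e X = a := by
        intro a haI
        rw [← he] at haI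
        exact haI
      have uc : u * F.c j = F.c j * u := hc j hj
      have us : u * star (F.c j) = star (F.c j) * u := by
        have := congrArg star uc
        rw [star_mul, star_mul, hs] at this
        exact this.symm
      have sb : star (u * F.c j) = star (F.c j) * u := by rw [star_mul, hs]
      have hcomm : ∀ a ∈ F.loc I, a * (u * F.c j) = (u * F.c j) * a ∧
          star a * (u * F.c j) = (u * F.c j) * star a := by
        intro a haI
        refine StarAlgebra.adjoin_induction (p := fun a _ => a * (u * F.c j) = (u * F.c j) * a ∧
          star a * (u * F.c j) = (u * F.c j) * star a) ?_ ?_ ?_ ?_ ?_ haI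
        · rintro _ ⟨i, hi, rfl⟩
          have hij : i ≠ j := fun h => hj (h ▸ hi)
          have ui : u * F.c i = -(F.c i * u) := ha i hi
          have usi : u * star (F.c i) = -(star (F.c i) * u) := by
            have := congrArg star ui
            rw [star_neg, star_mul, star_mul, hs] at this
            rw [this, neg_neg]
          constructor
          · rw [mul_assoc u, F.c_anti j i, mul_neg, ← mul_assoc u, ui, neg_mul, neg_neg, mul_assoc]
          · have h2 : F.c j * star (F.c i) = -(star (F.c i) * F.c j) := by
              rw [F.star_anti i j hij, neg_neg]
            rw [mul_assoc u, h2, mul_neg, ← mul_assoc u, usi, neg_mul, neg_neg, mul_assoc]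
        · intro r
          refine ⟨Algebra.commutes _ _, ?_⟩
          rw [← algebraMap_star_comm]
          exact Algebra.commutes _ _
        · rintro x y _ _ ⟨hx, hx'⟩ ⟨hy, hy'⟩
          exact ⟨by rw [add_mul, mul_add, hx, hy], by rw [star_add, add_mul, mul_add, hx', hy']⟩
        · rintro x y _ _ ⟨hx, hx'⟩ ⟨hy, hy'⟩
          exact ⟨by rw [mul_assoc, hy, ← mul_assoc, hx, mul_assoc],
            by rw [star_mul, mul_assoc, hx', ← mul_assoc, hy', mul_assoc]⟩
        · rintro x _ ⟨hx, hx'⟩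
          exact ⟨hx', by rw [star_star]; exact hx⟩
      have hbb : star (u * F.c j) * (u * F.c j) = star (F.c j) * F.c j := by
        rw [sb, mul_assoc, ← mul_assoc u, h1, one_mul]
      have hbb' : (u * F.c j) * star (u * F.c j) = F.c j * star (F.c j) := by
        rw [sb, uc, mul_assoc, ← mul_assoc u, us, mul_assoc, h1, mul_one]
      obtain ⟨e', h_form, h_e, U, hU⟩ := double e (u * F.c j)
        (by rw [mul_assoc, ← mul_assoc (F.c j), ← uc, mul_assoc u, F.c_sq, mul_zero, mul_zero])
        (by rw [hbb, hbb', F.car j j, if_pos rfl]) (fun X => (hcomm _ (e_mem X)).1)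
      refine ⟨Fin 2 × ι, inferInstance, inferInstance, e', le_antisymm ?_ ?_⟩
      · rintro _ ⟨M, rfl⟩
        obtain ⟨x, hx⟩ := h_form M
        have hb_mem : u * F.c j ∈ F.loc (insert j I) :=
          mul_mem (F.loc_mono I _ (Finset.subset_insert j I) hu)
            (F.c_mem j _ (Finset.mem_insert_self j I))
        have e_mem' : ∀ X, e X ∈ F.loc (insert j I) := fun X =>
          F.loc_mono I _ (Finset.subset_insert j I) (e_mem X)
        change e' M ∈ F.loc (insert j I)
        rw [hx]
        exact add_mem (add_mem (add_mem (mul_mem (e_mem' _) (mul_mem hb_mem (star_mem hb_mem)))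
          (mul_mem (e_mem' _) hb_mem)) (mul_mem (e_mem' _) (star_mem hb_mem)))
          (mul_mem (e_mem' _) (mul_mem (star_mem hb_mem) hb_mem))
      · refine StarAlgebra.adjoin_le ?_
        have old : ∀ a ∈ F.loc I, a ∈ e'.range := by
          intro a haI
          obtain ⟨X, rfl⟩ := mem_e a haI
          obtain ⟨M, hM⟩ := h_e X
          exact ⟨M, hM⟩
        rintro _ ⟨i, hi, rfl⟩
        rcases Finset.mem_insert.mp (Finset.mem_coe.mp hi) with rfl | hi
        · have : F.c i = u * (u * F.c i) := by rw [← mul_assoc, h1, one_mul]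
          rw [this]
          exact mul_mem (old u hu) ⟨U, hU⟩
        · exact old _ (F.c_mem i I hi)
  obtain ⟨ι, _, _, e, he⟩ := main
  have hι : Nonempty ι := by
    by_contra h
    rw [not_nonempty_iff] at h
    have h1 : e 1 = e 0 := congrArg e (Subsingleton.elim _ _)
    rw [map_one, map_zero] at h1
    exact one_ne_zero h1
  have hinj : Function.Injective e := (e : Matrix ι ι ℂ →+* 𝒜).injective
  let r : Matrix ι ι ℂ ≃⋆ₐ[ℂ] Matrix (Fin (Fintype.card ι)) (Fin (Fintype.card ι)) ℂ :=
    { Matrix.reindexAlgEquiv ℂ ℂ (Fintype.equivFin ι) with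
      map_star' := fun M => rfl
      map_smul' := fun c M => rfl }
  exact ⟨Fintype.card ι, ⟨(he ▸ (StarAlgEquiv.ofInjective e hinj).symm).trans r⟩⟩

/-- The quasi-local system of a fermion lattice system. -/
noncomputable def toQuasiLocal [Nontrivial 𝒜] : QuasiLocal Γ 𝒜 where
  loc := F.loc
  mono := F.loc_mono
  matrix := F.loc_matrix
  dense := F.local_dense

end FermionSystem

/-! ## Entropy -/

namespace QuasiLocal

variable {Γ 𝒜 : Type*} [DecidableEq Γ] [CStarAlgebra 𝒜] (Q : QuasiLocal Γ 𝒜)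

/-- The algebra of an arbitrary (finite or infinite) region: the norm closure of the union of the
algebras of its finite subregions. -/
def region (S : Set Γ) : Set 𝒜 := closure (⋃ I ∈ {I : Finset Γ | (I : Set Γ) ⊆ S}, (Q.loc I : Set 𝒜))

/-- The support of an element: the smallest region whose algebra contains it. -/
def support (a : 𝒜) : Set Γ := ⋂₀ {S : Set Γ | a ∈ Q.region S}

/-- The matrix dimension of a local algebra. -/
noncomputable def dim (I : Finset Γ) : ℕ := (Q.matrix I).choose

/-- An identification of a local algebra with a full matrix algebra; nothing below depends on which
one is taken, since any two differ by a unitary conjugation. -/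
noncomputable def toMatrix (I : Finset Γ) :
    Q.loc I ≃⋆ₐ[ℂ] Matrix (Fin (Q.dim I)) (Fin (Q.dim I)) ℂ := (Q.matrix I).choose_spec.some

/-- The density matrix `D` of the restriction of a state to a local algebra, with respect to the
matrix trace: `D i j = ψ (e j i)` with `e` the matrix units, so that `ψ a = Tr (D a)`. -/
noncomputable def density (I : Finset Γ) (ψ : State 𝒜) :
    Matrix (Fin (Q.dim I)) (Fin (Q.dim I)) ℂ :=
  Matrix.of fun i j => ψ ((Q.toMatrix I).symm (Matrix.single j i 1) : 𝒜)

theorem trace_density (I : Finset Γ) (ψ : State 𝒜) (a : Q.loc I) :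
    (Q.density I ψ * Q.toMatrix I a).trace = ψ (a : 𝒜) := by
  let L : Matrix (Fin (Q.dim I)) (Fin (Q.dim I)) ℂ →ₗ[ℂ] ℂ :=
    { toFun := fun X => ψ ((Q.toMatrix I).symm X : 𝒜)
      map_add' := fun X Y => by rw [map_add]; exact map_add ψ.toLin _ _
      map_smul' := fun r X => by rw [map_smul]; exact map_smul ψ.toLin _ _ }
  have hL : ∀ X, L X = (Q.density I ψ * X).trace := by
    intro X
    conv_lhs => rw [Matrix.matrix_eq_sum_single X]
    have : ∀ i j, L (Matrix.single i j (X i j)) = Q.density I ψ j i * X i j := by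
      intro i j
      have e : Matrix.single i j (X i j) = X i j • Matrix.single i j (1 : ℂ) := by
        simp [Matrix.smul_single]
      rw [e, map_smul, smul_eq_mul, mul_comm]
      rfl
    simp only [map_sum, this, Matrix.trace, Matrix.diag, Matrix.mul_apply]
    exact Finset.sum_comm
  rw [← hL]
  change ψ ((Q.toMatrix I).symm (Q.toMatrix I a) : 𝒜) = ψ (a : 𝒜)
  rw [StarAlgEquiv.symm_apply_apply]

/-- The von Neumann entropy `- Tr (D log D)` of a state on a finite region, where
`Real.negMulLog x = - x log x`. -/
noncomputable def entropy (I : Finset Γ) (ψ : State 𝒜) : ℝ :=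
  (cfc Real.negMulLog (Q.density I ψ)).trace.re

/-- The conditional entropy of a finite region `I` given a (finite or infinite) region `J`, an
infimum over the finite subsets of `J`, taken in the extended reals. -/
noncomputable def condEntropy (I : Finset Γ) (J : Set Γ) (ψ : State 𝒜) : EReal :=
  ⨅ L : {L : Finset Γ // (L : Set Γ) ⊆ J},
    ((Q.entropy (I ∪ L.1) ψ - Q.entropy L.1 ψ : ℝ) : EReal)

/-- The mutual entropy between a finite region and a disjoint (finite or infinite) region. -/
noncomputable def mutualEntropy (ψ : State 𝒜) (I : Finset Γ) (J : Set Γ) : EReal :=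
  (Q.entropy I ψ : EReal) - Q.condEntropy I J ψ

end QuasiLocal

/-! ## Potentials and local thermodynamical stability -/

/-- A potential: a self-adjoint element of the algebra of `K` for every finite region `K`, such that
for every finite region `I` the sum of the terms that meet both `I` and its complement converges in
norm, as a limit over the increasing finite regions `J` of the sums of the terms inside `J`.
Translation invariance is not required. -/
structure Potential {Γ 𝒜 : Type*} [DecidableEq Γ] [CStarAlgebra 𝒜] (Q : QuasiLocal Γ 𝒜) where
  /-- the interaction of a finite region -/
  term : Finset Γ → 𝒜
  mem_loc : ∀ K, term K ∈ Q.loc K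
  selfAdjoint : ∀ K, IsSelfAdjoint (term K)
  surface_exists : ∀ I : Finset Γ, ∃ h : 𝒜, Tendsto (fun J : Finset Γ =>
    ∑ K ∈ J.powerset with (K ∩ I).Nonempty ∧ (K \ I).Nonempty, term K) atTop (𝓝 h)

namespace Potential

variable {Γ 𝒜 : Type*} [DecidableEq Γ] [CStarAlgebra 𝒜] {Q : QuasiLocal Γ 𝒜} (Φ : Potential Q)

/-- The inner Hamiltonian: the sum of the terms inside `I`. -/
noncomputable def inner (I : Finset Γ) : 𝒜 := ∑ K ∈ I.powerset, Φ.term K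

/-- The surface energy: the sum of the terms that meet both `I` and its complement. -/
noncomputable def surface (I : Finset Γ) : 𝒜 := (Φ.surface_exists I).choose

theorem tendsto_surface (I : Finset Γ) : Tendsto (fun J : Finset Γ =>
    ∑ K ∈ J.powerset with (K ∩ I).Nonempty ∧ (K \ I).Nonempty, Φ.term K) atTop
      (𝓝 (Φ.surface I)) := (Φ.surface_exists I).choose_spec

/-- The boundary of a finite region: the support of the surface energy. -/
def boundary (I : Finset Γ) : Set Γ := Q.support (Φ.surface I)

/-- The boundary area: the number of sites of the boundary, `⊤` if it is infinite. -/
noncomputable def area (I : Finset Γ) : EReal := (((Φ.boundary I).encard : ENNReal) : EReal)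

/-- The conditional free energy of a state on a finite region at inverse temperature `β`. -/
noncomputable def freeEnergy (β : ℝ) (I : Finset Γ) (ψ : State 𝒜) : EReal :=
  ((ψ (Φ.inner I + Φ.surface I)).re : EReal) -
    ((1 / β : ℝ) : EReal) * Q.condEntropy I ((I : Set Γ)ᶜ) ψ

/-- Local thermodynamical stability: for every finite region `I`, the state minimizes the
conditional free energy among all states that agree with it on the complement of `I`. -/
def IsLTS (β : ℝ) (φ : State 𝒜) : Prop :=
  ∀ (I : Finset Γ) (ψ : State 𝒜), (∀ a ∈ Q.region ((I : Set Γ)ᶜ), ψ a = φ a) →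
    Φ.freeEnergy β I φ ≤ Φ.freeEnergy β I ψ

end Potential

/-- A potential of a fermion lattice system is even if all its terms are. -/
def FermionSystem.IsEvenPotential {Γ 𝒜 : Type*} [DecidableEq Γ] [CStarAlgebra 𝒜] [Nontrivial 𝒜]
    (F : FermionSystem Γ 𝒜) (Φ : Potential F.toQuasiLocal) : Prop :=
  ∀ K : Finset Γ, F.grading (Φ.term K) = Φ.term K

end QLattice

open QLattice

/-! The variational inequality is tested against one competitor: the product ω of the restrictions
of φ to `A` and to its complement. It agrees with φ on the complement, so LTS for `A` applies. It
also agrees with φ on the algebra of `A`, so the inner energies cancel and only the surface energy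
distinguishes the two states. For a product state S(A ∪ L) - S(L) = S(A) for every finite L outside
`A`, so its conditional entropy is at least S_A(φ). The inequality becomes I_φ(A : Aᶜ) ≤ β (ω(H_∂A)
- φ(H_∂A)) ≤ 2β ‖H_∂A‖, and the mutual entropy with a smaller region B is smaller because an infimum
over fewer finite sets is larger.

The competitor is built on the whole C*-algebra at once, by explicit Kraus operators in the algebra
of `A` (`State.exists_product`). It factorizes between that algebra and its commutant. Its entropies
follow from the additivity of entropy under Kronecker products (`trace_negMulLog_kronecker`).

What distinguishes the two kinds of system is isolated in `SplitsOff`. For spins, the algebra of L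
lies in the commutant of that of `A`. For fermions it does not, but it is unitarily conjugate to a
copy that does: even elements are kept and odd ones are multiplied by the parity u of `A`. Evenness
of φ makes this twist invisible to φ, and a product state for the twisted copy still restricts to φ
on the original algebra of L. -/

namespace Matrix

/-! ### Spectra, entropies and traces of matrices -/

variable {ι κ : Type*} [Fintype ι] [DecidableEq ι] [Fintype κ] [DecidableEq κ]

/-- The trace of a function of a Hermitian matrix, from a factorization of its characteristic
polynomial. -/
theorem IsHermitian.trace_cfc_of_charpoly_eq {M : Matrix ι ι ℂ} (hM : M.IsHermitian) (f : ℝ → ℝ)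
    {τ : Type*} [Fintype τ] (d : τ → ℝ)
    (h : M.charpoly = ∏ i, (Polynomial.X - Polynomial.C (d i : ℂ))) :
    (cfc f M).trace = ((∑ i, f (d i) : ℝ) : ℂ) := by
  have h1 : (cfc f M).trace = ((∑ i, f (hM.eigenvalues i) : ℝ) : ℂ) := by
    rw [hM.cfc_eq, IsHermitian.cfc, Unitary.conjStarAlgAut_apply, trace_mul_comm, ← mul_assoc]
    simp [trace_diagonal]
  have h2 : Multiset.map (fun i => (d i : ℂ)) Finset.univ.val =
      Multiset.map (fun i => (hM.eigenvalues i : ℂ)) Finset.univ.val := by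
    have h3 := hM.roots_charpoly_eq_eigenvalues
    rw [h, Polynomial.roots_prod _ _ (by
      simp [Finset.prod_ne_zero_iff, Polynomial.X_sub_C_ne_zero])] at h3
    simpa [Function.comp_def] using h3
  -- The two families agree as multisets of complex roots; taking real parts undoes the cast, so
  -- that `f` can be summed over them.
  have h4 := congrArg (fun s : Multiset ℂ => (s.map fun z => f z.re).sum) h2
  simp only [Multiset.map_map, Function.comp_def, Complex.ofReal_re] at h4
  rw [h1]
  exact congrArg _ h4.symm

/-- Both factors are diagonalized; the Kronecker product of the eigenvector unitaries then
diagonalizes the Kronecker product, and cyclicity of the characteristic polynomial cancels them. -/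
theorem IsHermitian.charpoly_kronecker {A : Matrix ι ι ℂ} {B : Matrix κ κ ℂ} (hA : A.IsHermitian)
    (hB : B.IsHermitian) : (kroneckerMap (· * ·) A B).charpoly =
      ∏ p : ι × κ, (Polynomial.X -
        Polynomial.C ((hA.eigenvalues p.1 * hB.eigenvalues p.2 : ℝ) : ℂ)) := by
  have e : kroneckerMap (· * ·) A B =
      kroneckerMap (· * ·) (hA.eigenvectorUnitary : Matrix ι ι ℂ)
          (hB.eigenvectorUnitary : Matrix κ κ ℂ) *
        kroneckerMap (· * ·) (diagonal (RCLike.ofReal ∘ hA.eigenvalues))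
          (diagonal (RCLike.ofReal ∘ hB.eigenvalues)) *
        kroneckerMap (· * ·) (star (hA.eigenvectorUnitary : Matrix ι ι ℂ))
          (star (hB.eigenvectorUnitary : Matrix κ κ ℂ)) := by
    rw [← mul_kronecker_mul, ← mul_kronecker_mul]
    congr 1
    · conv_lhs => rw [hA.spectral_theorem, Unitary.conjStarAlgAut_apply]
    · conv_lhs => rw [hB.spectral_theorem, Unitary.conjStarAlgAut_apply]
  rw [e, charpoly_mul_comm, ← mul_assoc, ← mul_kronecker_mul]
  simp [diagonal_kronecker_diagonal, charpoly_diagonal]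

/-- The entropy of a tensor product of Hermitian matrices of trace one. -/
theorem trace_negMulLog_kronecker {A : Matrix ι ι ℂ} {B : Matrix κ κ ℂ} (hA : A.IsHermitian)
    (hB : B.IsHermitian) (tA : A.trace = 1) (tB : B.trace = 1) :
    (cfc Real.negMulLog (kroneckerMap (· * ·) A B)).trace =
      (cfc Real.negMulLog A).trace + (cfc Real.negMulLog B).trace := by
  have hAB : (kroneckerMap (· * ·) A B).IsHermitian := by
    rw [IsHermitian, conjTranspose_kronecker, hA.eq, hB.eq]
  rw [hAB.trace_cfc_of_charpoly_eq _ _ (hA.charpoly_kronecker hB),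
    hA.trace_cfc_of_charpoly_eq _ hA.eigenvalues hA.charpoly_eq, hB.trace_cfc_of_charpoly_eq _ hB.eigenvalues hB.charpoly_eq]
  rw [hA.trace_eq_sum_eigenvalues] at tA
  rw [hB.trace_eq_sum_eigenvalues] at tB
  have sA : ∑ i, hA.eigenvalues i = 1 := Complex.ofReal_injective (by simpa using tA)
  have sB : ∑ i, hB.eigenvalues i = 1 := Complex.ofReal_injective (by simpa using tB)
  rw [← Complex.ofReal_add, Fintype.sum_prod_type]
  congr 1
  -- With η(x) = -x log x, η(xy) = y η(x) + x η(y); the stray factors sum to one.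
  simp only [Real.negMulLog_mul, Finset.sum_add_distrib, ← Finset.sum_mul, ← Finset.mul_sum, sA, sB,
    one_mul]

/-- A tracial linear functional on a full matrix algebra is a multiple of the trace. -/
theorem linearMap_eq_smul_trace (τ : Matrix ι ι ℂ →ₗ[ℂ] ℂ)
    (hτ : ∀ X Y, τ (X * Y) = τ (Y * X)) (i₀ : ι) (X : Matrix ι ι ℂ) :
    τ X = τ (single i₀ i₀ 1) * X.trace := by
  -- Off the diagonal, E_ii E_ij = E_ij while E_ij E_ii = 0; the diagonal units are linked by E_ii₀
  -- E_i₀i = E_ii and E_i₀i E_ii₀ = E_i₀i₀.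
  have off : ∀ i j, i ≠ j → τ (single i j 1) = 0 := by
    intro i j h
    have := hτ (single i i 1) (single i j 1)
    rwa [single_mul_single_same, single_mul_single_of_ne _ _ _ _ h.symm, map_zero, mul_one] at this
  have on : ∀ i, τ (single i i 1) = τ (single i₀ i₀ 1) := by
    intro i
    have := hτ (single i i₀ 1) (single i₀ i 1)
    rwa [single_mul_single_same, single_mul_single_same, mul_one] at this
  conv_lhs => rw [matrix_eq_sum_single X]
  have key : ∀ i j, τ (single i j (X i j)) = if i = j then τ (single i₀ i₀ 1) * X i j else 0 := by
    intro i j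
    have e : single i j (X i j) = X i j • single i j (1 : ℂ) := by simp [smul_single]
    rw [e, map_smul, smul_eq_mul]
    split_ifs with h
    · subst h
      rw [on, mul_comm]
    · rw [off i j h, mul_zero]
  simp [map_sum, key, trace, Finset.mul_sum]

/-- The pulled back trace is tracial, hence a multiple of the trace; equality of dimensions forces
equal sizes, and evaluation at 1 fixes the multiple. -/
theorem trace_starAlgEquiv (f : Matrix ι ι ℂ ≃⋆ₐ[ℂ] Matrix κ κ ℂ) (X : Matrix ι ι ℂ) :
    (f X).trace = X.trace := by
  rcases isEmpty_or_nonempty ι with h | ⟨⟨i₀⟩⟩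
  · rw [Subsingleton.elim X 0, map_zero, trace_zero, trace_zero]
  let τ : Matrix ι ι ℂ →ₗ[ℂ] ℂ :=
    { toFun := fun X => (f X).trace
      map_add' := fun X Y => by rw [map_add, trace_add]
      map_smul' := fun r X => by rw [map_smul, trace_smul, RingHom.id_apply] }
  have h := linearMap_eq_smul_trace τ
    (fun X Y => by change (f _).trace = (f _).trace; rw [map_mul, map_mul, trace_mul_comm]) i₀
  have hc : Fintype.card ι = Fintype.card κ := by
    let e : Matrix ι ι ℂ ≃ₗ[ℂ] Matrix κ κ ℂ :=
      { f with
        map_add' := map_add f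
        map_smul' := fun r X => map_smul f r X }
    have := e.finrank_eq
    simp only [Module.finrank_matrix, Module.finrank_self, mul_one] at this
    exact Nat.mul_self_inj.mp this
  have h1 := h 1
  change (f 1).trace = _ at h1
  rw [map_one, trace_one, trace_one, ← hc] at h1
  have h0 : (Fintype.card ι : ℂ) ≠ 0 := by
    have : Nonempty ι := ⟨i₀⟩
    exact_mod_cast Fintype.card_ne_zero
  have h2 : τ (single i₀ i₀ 1) = 1 := by
    have := mul_right_cancel₀ h0 ((one_mul _).trans h1)
    exact this.symm
  have := h X
  rwa [h2, one_mul] at this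

open scoped MatrixOrder Matrix.Norms.L2Operator in
theorem PosSemidef.exists_conjTranspose_mul_self {D : Matrix ι ι ℂ} (hD : D.PosSemidef) :
    ∃ B : Matrix ι ι ℂ, D = Bᴴ * B :=
  CStarAlgebra.nonneg_iff_eq_star_mul_self.mp hD.nonneg

end Matrix

/-! ### Tensor products of representations -/

/-- Commuting representations of two matrix algebras combine to one of their tensor product. -/
theorem exists_starAlgHom_kronecker {ι κ 𝒜 : Type*} [Fintype ι] [DecidableEq ι] [Fintype κ]
    [DecidableEq κ] [Ring 𝒜] [StarRing 𝒜] [Algebra ℂ 𝒜] (π₁ : Matrix ι ι ℂ →⋆ₐ[ℂ] 𝒜)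
    (π₂ : Matrix κ κ ℂ →⋆ₐ[ℂ] 𝒜) (hc : ∀ X Y, Commute (π₁ X) (π₂ Y)) :
    ∃ π : Matrix (ι × κ) (ι × κ) ℂ →⋆ₐ[ℂ] 𝒜,
      (∀ X Y, π (Matrix.kroneckerMap (· * ·) X Y) = π₁ X * π₂ Y) ∧
      ∀ M, π M ∈ Submodule.span ℂ {a | ∃ X Y, π₁ X * π₂ Y = a} := by
  let K := Matrix.kroneckerStarAlgEquiv ι κ ℂ
  let T : TensorProduct ℂ (Matrix ι ι ℂ) (Matrix κ κ ℂ) →ₐ[ℂ] 𝒜 :=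
    Algebra.TensorProduct.lift π₁.toAlgHom π₂.toAlgHom hc
  have hT : ∀ X Y, T (X ⊗ₜ Y) = π₁ X * π₂ Y := fun X Y => rfl
  let T' : TensorProduct ℂ (Matrix ι ι ℂ) (Matrix κ κ ℂ) →⋆ₐ[ℂ] 𝒜 :=
    { T with
      map_star' := fun x => by
        change T (star x) = star (T x)
        induction x with
        | zero => simp
        | add x y hx hy => rw [star_add, map_add, map_add, star_add, hx, hy]
        | tmul X Y =>
          rw [TensorProduct.star_tmul, hT, hT, star_mul, map_star, map_star]
          have := hc (star X) (star Y)
          rw [map_star, map_star] at this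
          exact this.eq }
  refine ⟨T'.comp (K.symm : _ →⋆ₐ[ℂ] _), fun X Y => ?_, fun M => ?_⟩
  · have : K.symm (Matrix.kroneckerMap (· * ·) X Y) = X ⊗ₜ Y := by
      rw [StarAlgEquiv.symm_apply_eq]
      simp [K]
    change T (K.symm _) = _
    rw [this, hT]
  · change T (K.symm M) ∈ _
    induction K.symm M with
    | zero => simp
    | add x y hx hy => rw [map_add]; exact add_mem hx hy
    | tmul X Y => exact Submodule.subset_span ⟨X, Y, (hT X Y).symm⟩

namespace QLattice

variable {Γ 𝒜 : Type*} [CStarAlgebra 𝒜]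

/-! ### States, their density matrices and the product construction -/

namespace State

theorem nonneg_apply [PartialOrder 𝒜] [StarOrderedRing 𝒜] (ψ : State 𝒜) {a : 𝒜} (ha : 0 ≤ a) :
    0 ≤ ψ a := by
  obtain ⟨b, rfl⟩ := CStarAlgebra.nonneg_iff_eq_star_mul_self.mp ha
  exact ψ.nonneg b

theorem continuous (ψ : State 𝒜) : Continuous ψ.toLin := by
  let := CStarAlgebra.spectralOrder 𝒜
  have := CStarAlgebra.spectralOrderedRing 𝒜
  exact map_continuous (PositiveLinearMap.mk₀ ψ.toLin fun x hx => ψ.nonneg_apply hx)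

theorem apply_star (ψ : State 𝒜) (a : 𝒜) : ψ (star a) = star (ψ a) := by
  let := CStarAlgebra.spectralOrder 𝒜
  have := CStarAlgebra.spectralOrderedRing 𝒜
  exact map_star (PositiveLinearMap.mk₀ ψ.toLin fun x hx => ψ.nonneg_apply hx) a

theorem re_le_norm (ψ : State 𝒜) {a : 𝒜} (ha : IsSelfAdjoint a) : (ψ a).re ≤ ‖a‖ := by
  let := CStarAlgebra.spectralOrder 𝒜
  have := CStarAlgebra.spectralOrderedRing 𝒜
  have h := ψ.nonneg_apply (sub_nonneg.mpr ha.le_algebraMap_norm_self)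
  have e : algebraMap ℝ 𝒜 ‖a‖ = (‖a‖ : ℂ) • (1 : 𝒜) := by
    rw [Algebra.algebraMap_eq_smul_one, Complex.coe_smul]
  rw [e, map_sub, map_smul, ψ.map_one, smul_eq_mul, mul_one, Complex.le_def] at h
  simpa using h.1

theorem re_sub_re_le (ψ φ : State 𝒜) {a : 𝒜} (ha : IsSelfAdjoint a) :
    (ψ a).re - (φ a).re ≤ 2 * ‖a‖ := by
  have h1 := ψ.re_le_norm ha
  have h2 := φ.re_le_norm ha.neg
  rw [map_neg, norm_neg, Complex.neg_re] at h2
  linarith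

/-- The state with Kraus operators `w`. -/
noncomputable def kraus (φ : State 𝒜) {κ : Type*} [Fintype κ] (w : κ → 𝒜)
    (hw : ∑ k, φ (star (w k) * w k) = 1) : State 𝒜 where
  toLin :=
    { toFun := fun x => ∑ k, φ (star (w k) * x * w k)
      map_add' := fun x y => by simp [mul_add, add_mul, Finset.sum_add_distrib]
      map_smul' := fun r x => by simp [Finset.mul_sum] }
  nonneg := fun a => Finset.sum_nonneg fun k _ => by
    have := φ.nonneg (a * w k)
    rwa [star_mul, mul_assoc, ← mul_assoc (star a), ← mul_assoc] at this
  map_one := by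
    change ∑ k, φ (star (w k) * 1 * w k) = 1
    simpa using hw

/-- The density matrix of a state in a representation of a matrix algebra. -/
noncomputable def matrixDensity {ι : Type*} [Fintype ι] [DecidableEq ι] (ψ : State 𝒜)
    (π : Matrix ι ι ℂ →⋆ₐ[ℂ] 𝒜) : Matrix ι ι ℂ :=
  Matrix.of fun i j => ψ (π (Matrix.single j i 1))

variable {ι : Type*} [Fintype ι] [DecidableEq ι] (ψ : State 𝒜)
  (π : Matrix ι ι ℂ →⋆ₐ[ℂ] 𝒜)

theorem trace_matrixDensity_mul (X : Matrix ι ι ℂ) :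
    (ψ.matrixDensity π * X).trace = ψ (π X) := by
  conv_rhs => rw [Matrix.matrix_eq_sum_single X]
  have : ∀ i j, ψ (π (Matrix.single i j (X i j))) = ψ.matrixDensity π j i * X i j := by
    intro i j
    have e : Matrix.single i j (X i j) = X i j • Matrix.single i j (1 : ℂ) := by
      simp [Matrix.smul_single]
    rw [e, map_smul, map_smul, smul_eq_mul, mul_comm]
    rfl
  simp only [map_sum, this, Matrix.trace, Matrix.diag, Matrix.mul_apply]
  exact Finset.sum_comm

theorem trace_matrixDensity : (ψ.matrixDensity π).trace = 1 := by
  rw [← mul_one (ψ.matrixDensity π), trace_matrixDensity_mul, _root_.map_one, ψ.map_one]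

theorem isHermitian_matrixDensity : (ψ.matrixDensity π).IsHermitian := by
  ext i j
  change star (ψ (π (Matrix.single i j 1))) = ψ (π (Matrix.single j i 1))
  rw [← ψ.apply_star, ← map_star π, Matrix.star_eq_conjTranspose, Matrix.conjTranspose_single,
    star_one]

theorem posSemidef_matrixDensity : (ψ.matrixDensity π).PosSemidef := by
  refine .of_dotProduct_mulVec_nonneg (ψ.isHermitian_matrixDensity π) fun x => ?_
  rcases isEmpty_or_nonempty ι with h | ⟨⟨i₀⟩⟩
  · simp
  -- The only nonzero row of Y is x*, so Y*Y = x x*, and positivity of ψ on it reads x* D x ≥ 0.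
  let Y : Matrix ι ι ℂ := Matrix.of fun i j => if i = i₀ then star (x j) else 0
  have hY : star Y * Y = Matrix.vecMulVec x (star x) := by
    ext i j
    simp [Y, Matrix.mul_apply, Matrix.star_apply, Matrix.vecMulVec_apply]
  have h := ψ.nonneg (π Y)
  rw [← map_star π, ← map_mul, hY, ← trace_matrixDensity_mul, Matrix.mul_vecMulVec,
    Matrix.trace_vecMulVec] at h
  rwa [dotProduct_comm]

/-- The product of a state on a represented matrix algebra with the same state on the commutant. -/
theorem exists_product [Nonempty ι] : ∃ ω : State 𝒜, ∀ X : Matrix ι ι ℂ, ∀ b : 𝒜,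
    (∀ Y, Commute (π Y) b) → ω (π X * b) = ψ (π X) * ψ b := by
  obtain ⟨B, hB⟩ := (ψ.posSemidef_matrixDensity π).exists_conjTranspose_mul_self
  -- With D = B*B and W_p = B* E_p, each W_p* X W_p is a diagonal entry of B X B* times a diagonal
  -- matrix unit; over all p these add up to Tr(B X B*) 1 = Tr(D X) 1.
  let W : ι × ι → Matrix ι ι ℂ := fun p => B.conjTranspose * Matrix.single p.1 p.2 1
  have key : ∀ X, ∑ p, star (W p) * X * W p = ψ (π X) • 1 := by
    intro X
    have e : ∀ p : ι × ι, star (W p) * X * W p =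
        (B * X * B.conjTranspose) p.1 p.1 • Matrix.single p.2 p.2 1 := by
      intro p
      have : star (W p) * X * W p = Matrix.single p.2 p.1 1 * (B * X * B.conjTranspose) *
          Matrix.single p.1 p.2 1 := by
        simp only [W, Matrix.star_eq_conjTranspose, Matrix.conjTranspose_mul,
          Matrix.conjTranspose_conjTranspose, Matrix.conjTranspose_single, star_one, mul_assoc]
      rw [this, Matrix.single_mul_mul_single]
      simp [Matrix.smul_single]
    simp only [e, Fintype.sum_prod_type, ← Finset.smul_sum, ← Finset.sum_smul]
    congr 1
    · change (B * X * B.conjTranspose).trace = _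
      rw [Matrix.trace_mul_comm, ← mul_assoc, ← hB, trace_matrixDensity_mul]
    · ext i j
      simp [Matrix.sum_apply, Matrix.single_apply, Matrix.one_apply, ite_and]
  -- An element of the commutant passes through the Kraus operators untouched.
  have hsum : ∀ X b, (∀ Y, Commute (π Y) b) →
      ∑ p, star (π (W p)) * (π X * b) * π (W p) = ψ (π X) • b := by
    intro X b hb
    have e : ∀ p, star (π (W p)) * (π X * b) * π (W p) = π (star (W p) * X * W p) * b := by
      intro p
      rw [map_mul π (star (W p) * X), map_mul π (star (W p)), map_star, ← mul_assoc, mul_assoc _ b, ← (hb (W p)).eq]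
      simp only [mul_assoc]
    simp only [e, ← Finset.sum_mul, ← map_sum, key, map_smul, _root_.map_one, smul_mul_assoc,
      one_mul]
  refine ⟨ψ.kraus (fun p => π (W p)) ?_, fun X b hb => ?_⟩
  · have := congrArg ψ.toLin (hsum 1 1 fun _ => Commute.one_right _)
    simpa [ψ.map_one] using this
  · have := congrArg ψ.toLin (hsum X b hb)
    rw [map_sum, map_smul] at this
    exact this

end State

/-! ### Entropy is independent of the representation -/

namespace QuasiLocal

variable [DecidableEq Γ] (Q : QuasiLocal Γ 𝒜)

/-- The entropy can be computed in any faithful representation of the matrix algebra. -/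
theorem entropy_eq {ι : Type*} [Fintype ι] [DecidableEq ι] (I : Finset Γ) (ψ : State 𝒜)
    (π : Matrix ι ι ℂ →⋆ₐ[ℂ] 𝒜) (hinj : Function.Injective π) (hπ : π.range = Q.loc I) :
    Q.entropy I ψ = (cfc Real.negMulLog (ψ.matrixDensity π)).trace.re := by
  let f : Matrix ι ι ℂ ≃⋆ₐ[ℂ] Matrix (Fin (Q.dim I)) (Fin (Q.dim I)) ℂ :=
    (hπ ▸ StarAlgEquiv.ofInjective π hinj : Matrix ι ι ℂ ≃⋆ₐ[ℂ] Q.loc I).trans (Q.toMatrix I)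
  have hf : ∀ X, (((Q.toMatrix I).symm (f X) : Q.loc I) : 𝒜) = π X := by
    intro X
    have : ∀ (S : StarSubalgebra ℂ 𝒜) (h : π.range = S),
        (((h ▸ StarAlgEquiv.ofInjective π hinj : Matrix ι ι ℂ ≃⋆ₐ[ℂ] S) X : S) : 𝒜) = π X := by
      rintro _ rfl
      rfl
    change (((Q.toMatrix I).symm (Q.toMatrix I _) : Q.loc I) : 𝒜) = π X
    rw [StarAlgEquiv.symm_apply_apply]
    exact this _ hπ
  -- A matrix is determined by its trace pairings, and f preserves traces.
  have hD : Q.density I ψ = f (ψ.matrixDensity π) := by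
    rw [Matrix.ext_iff_trace_mul_right]
    intro Y
    obtain ⟨X, rfl⟩ := f.surjective Y
    change (_ * f X).trace = (_ * f X).trace
    rw [← map_mul, Matrix.trace_starAlgEquiv, State.trace_matrixDensity_mul, ← hf,
      ← Q.trace_density, StarAlgEquiv.apply_symm_apply]
  have hsa : IsSelfAdjoint (ψ.matrixDensity π) := ψ.isHermitian_matrixDensity π
  have hcont : Continuous f := by
    let g : Matrix ι ι ℂ →ₗ[ℂ] Matrix (Fin (Q.dim I)) (Fin (Q.dim I)) ℂ :=
      { toFun := f, map_add' := map_add f, map_smul' := fun r X => map_smul f r X }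
    exact g.continuous_of_finiteDimensional
  rw [entropy, hD, ← StarAlgHomClass.map_cfc (S := ℂ) f Real.negMulLog (ψ.matrixDensity π)
    (by fun_prop) hcont hsa (hsa.map f), Matrix.trace_starAlgEquiv]

end QuasiLocal

end QLattice

namespace QLattice

variable {Γ 𝒜 : Type*} [CStarAlgebra 𝒜]

/-! ### Regions that split off, and the product state -/

namespace QuasiLocal

variable (Q : QuasiLocal Γ 𝒜)

/-- The inclusion of a local algebra, as a representation of the matrix algebra. -/
noncomputable def rep (I : Finset Γ) : Matrix (Fin (Q.dim I)) (Fin (Q.dim I)) ℂ →⋆ₐ[ℂ] 𝒜 :=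
  (Q.loc I).subtype.comp ((Q.toMatrix I).symm : _ →⋆ₐ[ℂ] _)

theorem rep_mem (I : Finset Γ) (X) : Q.rep I X ∈ Q.loc I := ((Q.toMatrix I).symm X).2

theorem exists_rep_eq {I : Finset Γ} {a : 𝒜} (ha : a ∈ Q.loc I) : ∃ X, Q.rep I X = a :=
  ⟨Q.toMatrix I ⟨a, ha⟩, congrArg Subtype.val ((Q.toMatrix I).symm_apply_apply ⟨a, ha⟩)⟩

theorem nonempty_dim [Nontrivial 𝒜] (I : Finset Γ) : Nonempty (Fin (Q.dim I)) := by
  by_contra h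
  rw [not_nonempty_iff] at h
  have h1 : Q.rep I 1 = Q.rep I 0 := congrArg _ (Subsingleton.elim _ _)
  rw [map_one, map_zero] at h1
  exact one_ne_zero h1

variable [DecidableEq Γ]

/-- The algebra of `A ∪ L` is the tensor product of the algebra of `A` and of a commuting copy of
the algebra of `L`, with the same restriction of the state, and a product state with respect to
this tensor product extends the restriction of the state to the algebra of `L`. -/
def SplitsOff (φ : State 𝒜) (A L : Finset Γ) : Prop :=
  ∃ θ : Q.loc L →⋆ₐ[ℂ] 𝒜,
    (∀ a ∈ Q.loc A, ∀ b, Commute a (θ b)) ∧ (∀ b, φ (θ b) = φ (b : 𝒜)) ∧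
    Q.loc A ⊔ θ.range = Q.loc (A ∪ L) ∧
    ∀ ω : State 𝒜, (∀ a ∈ Q.loc A, ∀ b, ω (a * θ b) = φ a * φ (θ b)) → ∀ b : Q.loc L, ω b = φ b

variable {Q}

/-- Multiplying the algebra of `A` with the commuting copy of that of L identifies the algebra of `A
∪ L` with a tensor product of matrix algebras, in which the density matrix of ω is a Kronecker
product. -/
theorem entropy_union [Nontrivial 𝒜] {φ ω : State 𝒜} {A L : Finset Γ} {θ : Q.loc L →⋆ₐ[ℂ] 𝒜}
    (hc : ∀ a ∈ Q.loc A, ∀ b, Commute a (θ b)) (hφ : ∀ b, φ (θ b) = φ (b : 𝒜))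
    (hsup : Q.loc A ⊔ θ.range = Q.loc (A ∪ L))
    (hω : ∀ a ∈ Q.loc A, ∀ b, ω (a * θ b) = φ a * φ (θ b)) :
    Q.entropy (A ∪ L) ω = Q.entropy A φ + Q.entropy L φ := by
  let ρ : Matrix (Fin (Q.dim L)) (Fin (Q.dim L)) ℂ →⋆ₐ[ℂ] 𝒜 :=
    θ.comp ((Q.toMatrix L).symm : _ →⋆ₐ[ℂ] _)
  obtain ⟨π, hπ, hspan⟩ := exists_starAlgHom_kronecker (Q.rep A) ρ
    fun X Y => hc _ (Q.rep_mem A X) _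
  have := Q.nonempty_dim A
  have := Q.nonempty_dim L
  -- A full matrix algebra of positive size is simple.
  have hinj : Function.Injective π :=
    (π : Matrix (Fin (Q.dim A) × Fin (Q.dim L)) (Fin (Q.dim A) × Fin (Q.dim L)) ℂ →+* 𝒜).injective
  have hrange : π.range = Q.loc (A ∪ L) := by
    rw [← hsup]
    refine le_antisymm ?_ (sup_le ?_ ?_)
    · rintro _ ⟨M, rfl⟩
      refine (Submodule.span_le (p := (Q.loc A ⊔ θ.range).toSubalgebra.toSubmodule)).mpr ?_
        (hspan M)
      rintro _ ⟨X, Y, rfl⟩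
      exact (Q.loc A ⊔ θ.range).mul_mem (le_sup_left (a := Q.loc A) (Q.rep_mem A X))
        (le_sup_right (a := Q.loc A) ⟨_, rfl⟩)
    · intro a ha
      obtain ⟨X, rfl⟩ := Q.exists_rep_eq ha
      exact ⟨Matrix.kroneckerMap (· * ·) X 1, (hπ X 1).trans (by rw [map_one, mul_one])⟩
    · rintro _ ⟨b, rfl⟩
      refine ⟨Matrix.kroneckerMap (· * ·) 1 (Q.toMatrix L b), (hπ _ _).trans ?_⟩
      rw [map_one, one_mul]
      exact congrArg θ ((Q.toMatrix L).symm_apply_apply b)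
  have hD : ω.matrixDensity π =
      Matrix.kroneckerMap (· * ·) (φ.matrixDensity (Q.rep A)) (φ.matrixDensity ρ) := by
    ext ⟨i, k⟩ ⟨j, l⟩
    change ω (π (Matrix.single (j, l) (i, k) 1)) = φ (Q.rep A (Matrix.single j i 1)) *
      φ (ρ (Matrix.single l k 1))
    have e := Matrix.single_kronecker_single j i l k (1 : ℂ) (1 : ℂ)
    rw [mul_one] at e
    rw [← e, hπ]
    exact hω _ (Q.rep_mem A _) _
  -- ρ uses the same identification with matrices as `density`, and φ does not see θ, so the density
  -- matrices agree entry by entry.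
  have hL : Q.density L φ = φ.matrixDensity ρ := by
    ext i j
    exact (hφ _).symm
  have hA : Q.density A φ = φ.matrixDensity (Q.rep A) := rfl
  rw [Q.entropy_eq _ ω π hinj hrange, hD, Matrix.trace_negMulLog_kronecker
    (φ.isHermitian_matrixDensity _) (φ.isHermitian_matrixDensity _) (φ.trace_matrixDensity _)
    (φ.trace_matrixDensity _), Complex.add_re, entropy, entropy, hL, hA]

/-- If every finite region in the complement of `A` splits off, the product of the restrictions of
the state to `A` and to its complement has conditional entropy at least the entropy on `A`. -/
theorem exists_product_state [Nontrivial 𝒜] (φ : State 𝒜) (A : Finset Γ)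
    (h : ∀ L, Disjoint A L → Q.SplitsOff φ A L) : ∃ ω : State 𝒜,
      (∀ a ∈ Q.loc A, ω a = φ a) ∧ (∀ a ∈ Q.region ((A : Set Γ)ᶜ), ω a = φ a) ∧
      (Q.entropy A φ : EReal) ≤ Q.condEntropy A ((A : Set Γ)ᶜ) ω := by
  have := Q.nonempty_dim A
  -- ω is chosen before any L: it factorizes against the whole commutant, which contains every copy
  -- θ(b).
  obtain ⟨ω, hω⟩ := φ.exists_product (Q.rep A)
  have hmul : ∀ a ∈ Q.loc A, ∀ b, (∀ a ∈ Q.loc A, Commute a b) → ω (a * b) = φ a * φ b := by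
    intro a ha b hb
    obtain ⟨X, rfl⟩ := Q.exists_rep_eq ha
    exact hω X b fun Y => hb _ (Q.rep_mem A Y)
  have hdisj : ∀ L : Finset Γ, (L : Set Γ) ⊆ (A : Set Γ)ᶜ → Disjoint A L := fun L hL =>
    Finset.disjoint_coe.mp (Set.disjoint_left.mpr fun x hA hx => hL hx hA)
  have hloc : ∀ L : Finset Γ, (L : Set Γ) ⊆ (A : Set Γ)ᶜ →
      (∀ b ∈ Q.loc L, ω b = φ b) ∧ Q.entropy (A ∪ L) ω = Q.entropy A φ + Q.entropy L φ := by
    intro L hL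
    obtain ⟨θ, hc, hφ, hsup, hext⟩ := h L (hdisj L hL)
    have hp : ∀ a ∈ Q.loc A, ∀ b, ω (a * θ b) = φ a * φ (θ b) := fun a ha b =>
      hmul a ha _ fun a' ha' => hc a' ha' b
    exact ⟨fun b hb => hext ω hp ⟨b, hb⟩, entropy_union hc hφ hsup hp⟩
  refine ⟨ω, fun a ha => ?_, ?_, le_iInf fun L => ?_⟩
  · have := hmul a ha 1 fun _ _ => Commute.one_right _
    rwa [mul_one, φ.map_one, mul_one] at this
  -- Agreement on finite regions passes to the norm closure because states are continuous.
  · refine closure_minimal (t := {a | ω a = φ a}) ?_ (isClosed_eq ω.continuous φ.continuous)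
    simp only [Set.iUnion_subset_iff]
    exact fun L hL b hb => (hloc L hL).1 b hb
  · have hd : Q.density L.1 ω = Q.density L.1 φ := by
      ext i j
      exact (hloc L.1 L.2).1 _ (SetLike.coe_mem _)
    have he : Q.entropy L.1 ω = Q.entropy L.1 φ := by rw [entropy, entropy, hd]
    rw [(hloc L.1 L.2).2, he, add_sub_cancel_right]

theorem condEntropy_anti (I : Finset Γ) {J K : Set Γ} (h : J ⊆ K) (ψ : State 𝒜) :
    Q.condEntropy I K ψ ≤ Q.condEntropy I J ψ :=
  le_iInf fun L => iInf_le_of_le ⟨L.1, L.2.trans h⟩ le_rfl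

end QuasiLocal

variable [DecidableEq Γ]

/-! ### From stability to the area bound -/

namespace Potential

variable {Q : QuasiLocal Γ 𝒜} (Φ : Potential Q)

theorem inner_mem (I : Finset Γ) : Φ.inner I ∈ Q.loc I :=
  sum_mem fun K hK => Q.mono K I (Finset.mem_powerset.mp hK) (Φ.mem_loc K)

theorem isSelfAdjoint_surface (I : Finset Γ) : IsSelfAdjoint (Φ.surface I) :=
  (isClosed_eq continuous_star continuous_id).mem_of_tendsto (Φ.tendsto_surface I)
    (Eventually.of_forall fun _ =>
      AddSubgroup.sum_mem (_root_.selfAdjoint 𝒜) fun K _ => Φ.selfAdjoint K)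

/-- This solves the free energy inequality for the entropy difference when conditional entropies may
be infinite. The finite lower bound s on C' makes the right-hand side finite, which rules out C = ⊥;
for C = ⊤ the conclusion is trivial. -/
theorem le_of_sub_mul_le {β s e₁ e₂ : ℝ} (hβ : 0 < β) {C C' : EReal} (hs : (s : EReal) ≤ C')
    (h : (e₁ : EReal) - ((1 / β : ℝ) : EReal) * C ≤ e₂ - ((1 / β : ℝ) : EReal) * C') :
    (s : EReal) - C ≤ ((β * (e₂ - e₁) : ℝ) : EReal) := by
  have hpos : 0 < 1 / β := by positivity
  have h' : (e₁ : EReal) - ((1 / β : ℝ) : EReal) * C ≤ ((e₂ - 1 / β * s : ℝ) : EReal) := by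
    refine h.trans ?_
    rw [EReal.coe_sub, EReal.coe_mul]
    exact EReal.sub_le_sub le_rfl
      (mul_le_mul_of_nonneg_left hs (EReal.coe_nonneg.mpr hpos.le))
  induction C with
  | bot =>
    rw [EReal.coe_mul_bot_of_pos hpos, EReal.coe_sub_bot, top_le_iff] at h'
    exact absurd h' (EReal.coe_ne_top _)
  | top => simp
  | coe C =>
    norm_cast at h' ⊢
    have : β * (e₁ - 1 / β * C) ≤ β * (e₂ - 1 / β * s) := mul_le_mul_of_nonneg_left h' hβ.le
    field_simp at this
    linarith

variable {Φ}

/-- Stability of `A` is tested on the product state. The factor 2 arises because the surface energy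
may take expectations of opposite sign, each of modulus up to its norm, in ω and φ. -/
theorem IsLTS.mutualEntropy_le [Nontrivial 𝒜] {β : ℝ} (hβ : 0 < β) {φ : State 𝒜}
    (hφ : Φ.IsLTS β φ) {A : Finset Γ} (h : ∀ L, Disjoint A L → Q.SplitsOff φ A L) {B : Set Γ}
    (hB : Disjoint (A : Set Γ) B) :
    Q.mutualEntropy φ A B ≤ ((2 * β * ‖Φ.surface A‖ : ℝ) : EReal) := by
  obtain ⟨ω, hA, hAc, hs⟩ := QuasiLocal.exists_product_state φ A h
  have hF := le_of_sub_mul_le hβ hs (hφ A ω hAc)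
  have hmono := QuasiLocal.condEntropy_anti (Q := Q) A
    (Set.subset_compl_iff_disjoint_left.mpr hB) φ
  refine (EReal.sub_le_sub le_rfl hmono).trans (hF.trans (EReal.coe_le_coe_iff.mpr ?_))
  have h1 := ω.re_sub_re_le φ (Φ.isSelfAdjoint_surface A)
  -- The inner energy lies in the algebra of `A`, where ω and φ coincide, and therefore drops out.
  rw [map_add, map_add, hA _ (Φ.inner_mem A), Complex.add_re, Complex.add_re]
  nlinarith

theorem IsLTS.mutualEntropy_le_area [Nontrivial 𝒜] {β : ℝ} (hβ : 0 < β) {φ : State 𝒜}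
    (hφ : Φ.IsLTS β φ) {c : ℝ} {A : Finset Γ}
    (hA : ((‖Φ.surface A‖ : ℝ) : EReal) ≤ (c : EReal) * Φ.area A)
    (h : ∀ L, Disjoint A L → Q.SplitsOff φ A L) {B : Set Γ} (hB : Disjoint (A : Set Γ) B) :
    Q.mutualEntropy φ A B ≤ ((2 * β * c : ℝ) : EReal) * Φ.area A := by
  refine (hφ.mutualEntropy_le hβ h hB).trans ?_
  rw [EReal.coe_mul, EReal.coe_mul _ c, mul_assoc]
  exact mul_le_mul_of_nonneg_left hA (EReal.coe_nonneg.mpr (by positivity))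

end Potential

/-! ### Splitting for spin systems: the copy is the subalgebra itself -/

theorem SpinSystem.splitsOff (S : SpinSystem Γ 𝒜) (φ : State 𝒜) {A L : Finset Γ}
    (h : Disjoint A L) : S.toQuasiLocal.SplitsOff φ A L := by
  refine ⟨(S.loc L).subtype, fun a ha b => S.commute A L h a ha b b.2, fun _ => rfl, ?_,
    fun ω hω b => ?_⟩
  · rw [S.sup A L h]
    congr 1
    ext a
    exact ⟨by rintro ⟨b, rfl⟩; exact b.2, fun ha => ⟨⟨a, ha⟩, rfl⟩⟩
  · have := hω 1 (one_mem _) b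
    rwa [one_mul, φ.map_one, one_mul] at this

/-- Two star subalgebras commute if generators commute with generators and their adjoints. -/
theorem commute_of_mem_adjoin {s t : Set 𝒜}
    (h : ∀ a ∈ s, ∀ b ∈ t, Commute a b) (h' : ∀ a ∈ s, ∀ b ∈ t, Commute a (star b)) {a b : 𝒜}
    (ha : a ∈ StarAlgebra.adjoin ℂ s) (hb : b ∈ StarAlgebra.adjoin ℂ t) : Commute a b := by
  -- One side is generated at a time: centralizers here commute with adjoints too, so they are star
  -- subalgebras.
  have h1 : StarAlgebra.adjoin ℂ s ≤ StarSubalgebra.centralizer ℂ t := by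
    refine StarAlgebra.adjoin_le fun x hx => ?_
    rw [SetLike.mem_coe, StarSubalgebra.mem_centralizer_iff]
    exact fun y hy => ⟨(h x hx y hy).eq.symm, (h' x hx y hy).eq.symm⟩
  have h2 : StarAlgebra.adjoin ℂ t ≤
      StarSubalgebra.centralizer ℂ (StarAlgebra.adjoin ℂ s : Set 𝒜) := by
    refine StarAlgebra.adjoin_le fun y hy => ?_
    rw [SetLike.mem_coe, StarSubalgebra.mem_centralizer_iff]
    exact fun x hx => ⟨(((StarSubalgebra.mem_centralizer_iff ℂ).mp (h1 hx) y hy).1).symm,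
      (((StarSubalgebra.mem_centralizer_iff ℂ).mp (h1 (star_mem hx)) y hy).1).symm⟩
  exact ((StarSubalgebra.mem_centralizer_iff ℂ).mp (h2 hb) a ha).1

/-! ### Splitting for fermion systems by a parity twist -/

namespace FermionSystem

/-- Conjugation by the unitary that is `1` where `u = 1`, and `v` where `u = -1`. -/
theorem twist_conj {u v b : 𝒜} (hu : u * u = 1) (huv : u * v = v * u) (hub : u * b = b * u) :
    ((2⁻¹ : ℂ) • (1 + u) + (2⁻¹ : ℂ) • ((1 - u) * v)) * b *
      ((2⁻¹ : ℂ) • (1 + u) + (2⁻¹ : ℂ) • ((1 - u) * v)) =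
      (2⁻¹ : ℂ) • (b + v * b * v) + (2⁻¹ : ℂ) • (u * (b - v * b * v)) := by
  have huu : ∀ x, u * (u * x) = x := fun x => by rw [← mul_assoc, hu, one_mul]
  have hvu : ∀ x, v * (u * x) = u * (v * x) := fun x => by rw [← mul_assoc, ← huv, mul_assoc]
  have hbu : ∀ x, b * (u * x) = u * (b * x) := fun x => by rw [← mul_assoc, ← hub, mul_assoc]
  simp only [mul_add, add_mul, mul_sub, sub_mul, mul_one, one_mul, smul_mul_assoc, mul_smul_comm,
    mul_assoc, huu, hvu, hbu, ← hub]
  module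

variable (F : FermionSystem Γ 𝒜)

theorem commute_of_commute_c {x : 𝒜} (hx : star x = x) {L : Finset Γ}
    (h : ∀ j ∈ L, x * F.c j = F.c j * x) {b : 𝒜} (hb : b ∈ F.loc L) : x * b = b * x := by
  refine (commute_of_mem_adjoin (s := {x}) (t := F.c '' (L : Set Γ)) ?_ ?_
    (StarAlgebra.subset_adjoin ℂ _ rfl) hb).eq
  · rintro _ rfl _ ⟨j, hj, rfl⟩
    exact h j hj
  · rintro x rfl _ ⟨j, hj, rfl⟩
    have := congrArg star (h j hj)
    rw [star_mul, star_mul, hx] at this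
    exact this.symm

/-- Θ and conjugation by v are star homomorphisms that agree on the generators. -/
theorem grading_eq_conj {v : 𝒜} (hs : star v = v) (h1 : v * v = 1) {L : Finset Γ}
    (h : ∀ j ∈ L, v * F.c j = -(F.c j * v)) {b : 𝒜} (hb : b ∈ F.loc L) :
    F.grading b = v * b * v := by
  refine StarAlgebra.adjoin_induction (p := fun b _ => F.grading b = v * b * v) ?_ ?_ ?_ ?_ ?_ hb
  · rintro _ ⟨j, hj, rfl⟩
    rw [F.grading_c, h j hj, neg_mul, mul_assoc, h1, mul_one]
  · intro r
    rw [← Algebra.commutes, mul_assoc, h1, mul_one]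
    exact AlgHomClass.commutes F.grading r
  · intro x y _ _ hx hy
    rw [map_add, hx, hy, mul_add, add_mul]
  · intro x y _ _ hx hy
    calc F.grading (x * y) = v * x * v * (v * y * v) := by rw [map_mul, hx, hy]
      _ = v * x * (v * v) * y * v := by simp only [mul_assoc]
      _ = v * (x * y) * v := by rw [h1]; simp only [mul_assoc, one_mul]
  · intro x _ hx
    rw [map_star, hx]
    simp [star_mul, hs, mul_assoc]

/-- With u and v the parities of `A` and L, conjugation by w fixes even b in the algebra of L and
sends odd b to u b. The factor u supplies a second sign that cancels the anticommutation with the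
generators of `A`. An even φ vanishes on both b and u b for odd b, so the twist preserves φ. -/
theorem splitsOff [Nontrivial 𝒜] {φ : State 𝒜} (hφ : F.IsEvenState φ) {A L : Finset Γ}
    (h : Disjoint A L) : F.toQuasiLocal.SplitsOff φ A L := by
  obtain ⟨u, hu, us, u1, ua, uc⟩ := F.exists_parity A
  obtain ⟨v, hv, vs, v1, va, vc⟩ := F.exists_parity L
  have huL : ∀ b ∈ F.loc L, u * b = b * u := fun b hb =>
    F.commute_of_commute_c us (fun j hj => uc j (Finset.disjoint_right.mp h hj)) hb
  have huv := huL v hv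
  have hconj := fun b (hb : b ∈ F.loc L) => twist_conj u1 huv (huL b hb)
  set w : 𝒜 := (2⁻¹ : ℂ) • (1 + u) + (2⁻¹ : ℂ) • ((1 - u) * v) with hw
  have ws : star w = w := by
    simp only [hw, star_add, star_smul, star_mul, star_sub, star_one, us, vs]
    rw [mul_sub, sub_mul, huv]
    simp
  -- The conjugation formula at b = 1.
  have w1 : w * w = 1 := by
    have := hconj 1 (one_mem _)
    rw [mul_one, mul_one, v1, sub_self, mul_zero, smul_zero, add_zero] at this
    rw [this]
    module
  have wmem : w ∈ F.loc (A ∪ L) := by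
    have hu' := F.loc_mono A (A ∪ L) Finset.subset_union_left hu
    have hv' := F.loc_mono L (A ∪ L) Finset.subset_union_right hv
    exact add_mem (SMulMemClass.smul_mem _ (add_mem (one_mem _) hu'))
      (SMulMemClass.smul_mem _ (mul_mem (sub_mem (one_mem _) hu') hv'))
  let W : unitary 𝒜 := ⟨w, by rw [Unitary.mem_iff, ws]; exact ⟨w1, w1⟩⟩
  let σ : 𝒜 →⋆ₐ[ℂ] 𝒜 := (Unitary.conjStarAlgAut ℂ 𝒜 W : 𝒜 →⋆ₐ[ℂ] 𝒜)
  have hσ : ∀ b, σ b = w * b * w := by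
    intro b
    change w * b * star w = _
    rw [ws]
  have σc : ∀ j ∈ L, σ (F.c j) = u * F.c j := by
    intro j hj
    have e : v * F.c j * v = -F.c j := by rw [va j hj, neg_mul, mul_assoc, v1, mul_one]
    rw [hσ, hconj _ (F.c_mem j L hj), e, add_neg_cancel, smul_zero, zero_add, sub_neg_eq_add,
      mul_add]
    module
  have gA : ∀ j ∈ L, F.c j = u * σ (F.c j) := by
    intro j hj
    rw [σc j hj, ← mul_assoc, u1, one_mul]
  have gv : ∀ b ∈ F.loc L, φ (v * b * v) = φ b := by
    intro b hb
    rw [← F.grading_eq_conj vs v1 va hb, hφ]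
  have hvv : ∀ b, v * (v * b * v) * v = b := fun b => by
    rw [mul_assoc v b, ← mul_assoc v v, v1, one_mul, mul_assoc, v1, mul_one]
  -- b - v b v is twice the odd part of b and u is even, so the product is odd and an even state
  -- annihilates it.
  have hodd : ∀ b ∈ F.loc L, φ (u * (b - v * b * v)) = 0 := by
    intro b hb
    have e : F.grading (u * (b - v * b * v)) = -(u * (b - v * b * v)) := by
      rw [map_mul, map_sub, F.grading_eq_conj us u1 ua hu, F.grading_eq_conj vs v1 va hb,
        F.grading_eq_conj vs v1 va (mul_mem (mul_mem hv hb) hv), hvv, u1, one_mul, ← mul_neg,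
        neg_sub]
    have := hφ (u * (b - v * b * v))
    rw [e, map_neg] at this
    exact self_eq_neg.mp this.symm
  have hφσ : ∀ b ∈ F.loc L, φ (σ b) = φ b := by
    intro b hb
    rw [hσ, hconj b hb, map_add, map_smul, map_smul, hodd b hb, map_add, gv b hb, smul_zero,
      add_zero, ← two_smul ℂ, smul_smul]
    norm_num
  let θ : F.loc L →⋆ₐ[ℂ] 𝒜 := σ.comp (F.loc L).subtype
  refine ⟨θ, fun a ha b => ?_, fun b => hφσ b b.2, ?_, fun ω hω b => ?_⟩
  · have hb : σ b ∈ StarAlgebra.adjoin ℂ (σ '' (F.c '' (L : Set Γ))) := by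
      rw [← StarAlgHom.map_adjoin]
      exact ⟨b, b.2, rfl⟩
    refine commute_of_mem_adjoin ?_ ?_ ha hb
    -- c_i picks up one sign from c_j and another from u. The next case does the same for the
    -- adjoint of u c_j, where i ≠ j is needed.
    · rintro _ ⟨i, hi, rfl⟩ _ ⟨_, ⟨j, hj, rfl⟩, rfl⟩
      rw [σc j hj, Commute, SemiconjBy, mul_assoc u, F.c_anti j i, mul_neg, ← mul_assoc u,
        ua i hi, neg_mul, neg_neg, mul_assoc]
    · rintro _ ⟨i, hi, rfl⟩ _ ⟨_, ⟨j, hj, rfl⟩, rfl⟩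
      have hij : j ≠ i := fun e => Finset.disjoint_right.mp h hj (e ▸ hi)
      rw [σc j hj, Commute, SemiconjBy, star_mul, us, mul_assoc, ua i hi, mul_neg,
        ← mul_assoc (star (F.c j)), F.star_anti j i hij, neg_mul, neg_neg, mul_assoc]
  · change F.loc A ⊔ θ.range = F.loc (A ∪ L)
    refine le_antisymm (sup_le (F.loc_mono A _ Finset.subset_union_left) ?_) ?_
    · rintro _ ⟨b, rfl⟩
      change σ b ∈ _
      rw [hσ]
      exact mul_mem (mul_mem wmem (F.loc_mono L _ Finset.subset_union_right b.2)) wmem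
    -- The twist is undone inside the join, since u belongs to the algebra of `A`: c_j = u σ(c_j).
    · refine StarAlgebra.adjoin_le ?_
      rintro _ ⟨i, hi, rfl⟩
      rcases Finset.mem_union.mp (Finset.mem_coe.mp hi) with hi | hi
      · exact le_sup_left (a := F.loc A) (F.c_mem i A hi)
      · rw [gA i hi]
        exact mul_mem (le_sup_left (a := F.loc A) hu)
          (le_sup_right (a := F.loc A) ⟨⟨F.c i, F.c_mem i L hi⟩, rfl⟩)
  -- Even and odd parts of b, both doubled, are tested separately. The even part is its own copy, so
  -- factorization with a = 1 gives φ. The odd part is u times its copy, so a = u gives φ(u) times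
  -- the value of φ on that copy, which is zero.
  · obtain ⟨b, hb⟩ := b
    change ω b = φ b
    have hvbv : v * b * v ∈ F.loc L := mul_mem (mul_mem hv hb) hv
    have me : b + v * b * v ∈ F.loc L := add_mem hb hvbv
    have mo : b - v * b * v ∈ F.loc L := sub_mem hb hvbv
    have he : σ (b + v * b * v) = b + v * b * v := by
      rw [hσ, hconj _ me, mul_add v, add_mul _ _ v, hvv]
      rw [add_comm (v * b * v) b, sub_self, mul_zero, smul_zero, add_zero]
      module
    have ho : σ (b - v * b * v) = u * (b - v * b * v) := by
      rw [hσ, hconj _ mo, mul_sub v, sub_mul _ _ v, hvv]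
      have e1 : b - v * b * v + (v * b * v - b) = 0 := by abel
      have e2 : b - v * b * v - (v * b * v - b) = (2 : ℂ) • (b - v * b * v) := by module
      rw [e1, e2, smul_zero, zero_add, mul_smul_comm, smul_smul]
      norm_num
    have hωe := hω 1 (one_mem _) ⟨_, me⟩
    have hωo := hω u hu ⟨_, mo⟩
    change ω (1 * σ (b + v * b * v)) = φ 1 * φ (σ (b + v * b * v)) at hωe
    change ω (u * σ (b - v * b * v)) = φ u * φ (σ (b - v * b * v)) at hωo
    rw [he, one_mul, φ.map_one, one_mul, map_add φ.toLin, gv b hb] at hωe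
    rw [ho, hodd b hb, mul_zero, ← mul_assoc, u1, one_mul] at hωo
    have hsum : (2 : ℂ) • b = (b + v * b * v) + (b - v * b * v) := by module
    have := congrArg ω.toLin hsum
    rw [map_add, hωe, hωo, map_smul, smul_eq_mul, add_zero, ← two_mul] at this
    exact mul_left_cancel₀ two_ne_zero this

end FermionSystem

end QLattice

theorem corollary1 {Γ : Type*} {𝒜 : Type*} [DecidableEq Γ] [CStarAlgebra 𝒜] [Nontrivial 𝒜] :
    (∀ (S : SpinSystem Γ 𝒜) (Φ : Potential S.toQuasiLocal) (β : ℝ), 0 < β →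
      ∀ φ : State 𝒜, Φ.IsLTS β φ →
      ∀ c : ℝ, 0 < c → ∀ A : Finset Γ, ((‖Φ.surface A‖ : ℝ) : EReal) ≤ (c : EReal) * Φ.area A →
      ∀ B : Set Γ, Disjoint (A : Set Γ) B →
        S.toQuasiLocal.mutualEntropy φ A B ≤ ((2 * β * c : ℝ) : EReal) * Φ.area A) ∧
    (∀ (F : FermionSystem Γ 𝒜) (Φ : Potential F.toQuasiLocal), F.IsEvenPotential Φ →
      ∀ β : ℝ, 0 < β → ∀ φ : State 𝒜, F.IsEvenState φ → Φ.IsLTS β φ →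
      ∀ c : ℝ, 0 < c → ∀ A : Finset Γ, ((‖Φ.surface A‖ : ℝ) : EReal) ≤ (c : EReal) * Φ.area A →
      ∀ B : Set Γ, Disjoint (A : Set Γ) B →
        F.toQuasiLocal.mutualEntropy φ A B ≤ ((2 * β * c : ℝ) : EReal) * Φ.area A) :=
  ⟨fun S _ _ hβ φ hφ _ _ _ hA _ hB =>
    hφ.mutualEntropy_le_area hβ hA (fun _ h => S.splitsOff φ h) hB,
  fun F _ _ _ hβ _ he hφ _ _ _ hA _ hB =>
    hφ.mutualEntropy_le_area hβ hA (fun _ h => F.splitsOff he h) hB⟩
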